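/- Let $\mathcal X,\mathcal S,\mathcal Y$ be arbitrary measurable alphabets ($\mathcal X\ne\emptyset$). Let $\mathbf W=\{W^n\}_{n\ge1}$ be an arbitrary sequence of stochastic kernels $W^n:\mathcal X^n\times\mathcal S^n\to\mathcal Y^n$ and let $\mathbf S=\{P_{S^n}\}_{n\ge1}$ be an arbitrary sequence of probability laws on $\mathcal S^n$ (no stationarity, memorylessness, ergodicity or consistency in $n$ is assumed). An $(n,M_n,\epsilon_n)$ code consists of a possibly randomized encoder $f_n:[1:M_n]\times\mathcal S^n\to\mathcal X^n$ and a decoder $\varphi_n:\mathcal Y^n\to[1:M_n]$ such that, for a message $m$ uniform on $[1:M_n]$ and independent of $S^n\sim P_{S^n}$, the average error probability satisfies $$\frac1{M_n}\sum_{m=1}^{M_n}\int_{\mathcal S^n}\mathbb E\big[W^n(\{y^n:\varphi_n(y^n)\neq m\}\mid f_n(m,s^n),s^n)\big]\,P_{S^n}(ds^n)\le\epsilon_n ,$$ the expectation being over the randomness of the encoder. A number $R\ge0$ is $\epsilon$-achievable if there is a sequence of $(n,M_n,\epsilon_n)$ codes with $\liminf_{n\to\infty}\frac1n\log M_n\ge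 R$ and $\limsup_{n\to\infty}\epsilon_n\le\epsilon$; $C_\epsilon$ is the supremum of the $\epsilon$-achievable rates, and the Gel'fand–Pinsker capacity is $C=\lim_{\epsilon\downarrow0}C_\epsilon\in[0,\infty]$. For extended real random variables $Z_n$ put $\operatorname{p-lim\,sup}_n Z_n=\inf\{\alpha:\lim_n\Pr(Z_n>\alpha)=0\}$ and $\operatorname{p-lim\,inf}_n Z_n=-\operatorname{p-lim\,sup}_n(-Z_n)$. For a sequence of pairs $(A^n,B^n)$ let $\overline I(\mathbf A;\mathbf B)$ and $\underline I(\mathbf A;\mathbf B)$ be the $\operatorname{p-lim\,sup}$ and the $\operatorname{p-lim\,inf}$ of $\frac1n\log\frac{dP_{A^nB^n}}{d(P_{A^n}\times P_{B^n})}(A^n,B^n)$, where the density is $+\infty$ on the part of $P_{A^nB^n}$ that is singular to $P_{A^n}\times P_{B^n}$. Then the limit defining $C$ exists and $$C=\sup\big\{\underline I(\mathbf U;\mathbf Y)-\overline I(\mathbf U;\mathbf S)\big\}$$ with the convention $\infty-\infty=-\infty$, where the supremum is over all measurable auxiliary alphabets $\mathcal U$ and all sequences $\{(U^n,X^n,S^n,Y^n)\}_{n\ge1}$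 of random variables with values in $\mathcal U^n\times\mathcal X^n\times\mathcal S^n\times\mathcal Y^n$ such that, for every $n$, $S^n$ has law $P_{S^n}$, $U^n-(X^n,S^n)-Y^n$ is a Markov chain, the conditional law of $Y^n$ given $(X^n,S^n)$ is $W^n$, and $X^n$ has a regular conditional law given $(U^n,S^n)$ (the last condition is automatic if $\mathcal X$ is a standard Borel space, in particular if it is finite or countable). -/

import Mathlib

open MeasureTheory ProbabilityTheory Filter Topology
open scoped ENNReal

universe v a b c

noncomputable section

/-- The limit superior in probability of `Z n`, a random variable on the space `(Ω n, P n)`. -/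
def pLimsup {Ω : ℕ → Type*} [∀ n, MeasurableSpace (Ω n)] (P : ∀ n, Measure (Ω n))
    (Z : ∀ n, Ω n → EReal) : EReal :=
  sInf {α : EReal | Tendsto (fun n => P n {ω | α < Z n ω}) atTop (𝓝 0)}

/-- The limit inferior in probability. -/
def pLiminf {Ω : ℕ → Type*} [∀ n, MeasurableSpace (Ω n)] (P : ∀ n, Measure (Ω n))
    (Z : ∀ n, Ω n → EReal) : EReal :=
  - pLimsup P (fun n ω => - Z n ω)

/-- The information density `log (dP_{AB} / d(P_A × P_B))` of a joint law `P` on `A × B`.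
Both measures are differentiated with respect to their sum, so that the density is `+∞` on the
part of `P` that is singular to `P_A × P_B`; on the part that is absolutely continuous it is the
logarithm of the Radon-Nikodym derivative (for discrete laws, of `P(b|a) / P(b)`). -/
def infoDensity {A B : Type*} [MeasurableSpace A] [MeasurableSpace B] (P : Measure (A × B))
    (z : A × B) : EReal :=
  ENNReal.log (P.rnDeriv (P + P.fst.prod P.snd) z /
    (P.fst.prod P.snd).rnDeriv (P + P.fst.prod P.snd) z)

/-- The spectral sup-mutual information rate of a sequence of joint laws. -/
def spectralSupMI {A B : ℕ → Type*} [∀ n, MeasurableSpace (A n)] [∀ n, MeasurableSpace (B n)]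
    (P : ∀ n, Measure (A n × B n)) : EReal :=
  pLimsup P (fun n z => infoDensity (P n) z / (n : EReal))

/-- The spectral inf-mutual information rate of a sequence of joint laws. -/
def spectralInfMI {A B : ℕ → Type*} [∀ n, MeasurableSpace (A n)] [∀ n, MeasurableSpace (B n)]
    (P : ∀ n, Measure (A n × B n)) : EReal :=
  pLiminf P (fun n z => infoDensity (P n) z / (n : EReal))

section GelfandPinsker

variable {𝒳 : Type a} {𝒮 : Type b} {𝒴 : Type c}
  [MeasurableSpace 𝒳] [MeasurableSpace 𝒮] [MeasurableSpace 𝒴]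

/-- A code of blocklength `n` with `M` messages: a possibly randomized encoder, which sees the
message and the whole state sequence, and a deterministic decoder, which sees the output only. -/
structure GPCode (𝒳 : Type a) (𝒮 : Type b) (𝒴 : Type c)
    [MeasurableSpace 𝒳] [MeasurableSpace 𝒮] [MeasurableSpace 𝒴] (n M : ℕ) where
  enc : Fin M → Kernel (Fin n → 𝒮) (Fin n → 𝒳)
  enc_markov : ∀ m, IsMarkovKernel (enc m)
  dec : (Fin n → 𝒴) → Fin M
  dec_measurable : Measurable dec

/-- The average error probability for a uniform message that is independent of the state. -/
def GPCode.error {n M : ℕ} (code : GPCode 𝒳 𝒮 𝒴 n M)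
    (W : Kernel ((Fin n → 𝒳) × (Fin n → 𝒮)) (Fin n → 𝒴)) (PS : Measure (Fin n → 𝒮)) : ℝ≥0∞ :=
  (M : ℝ≥0∞)⁻¹ * ∑ m : Fin M,
    ∫⁻ s, ∫⁻ x, W (x, s) {y | code.dec y ≠ m} ∂(code.enc m s) ∂PS

/-- There is an `(n, M, ε)` code. -/
def HasGPCode {n : ℕ} (W : Kernel ((Fin n → 𝒳) × (Fin n → 𝒮)) (Fin n → 𝒴))
    (PS : Measure (Fin n → 𝒮)) (M : ℕ) (ε : ℝ≥0∞) : Prop :=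
  0 < M ∧ ∃ code : GPCode 𝒳 𝒮 𝒴 n M, code.error W PS ≤ ε

/-- The nonnegative number `R` is an `ε`-achievable rate. -/
def IsAchievableRate (W : ∀ n : ℕ, Kernel ((Fin n → 𝒳) × (Fin n → 𝒮)) (Fin n → 𝒴))
    (PS : ∀ n : ℕ, Measure (Fin n → 𝒮)) (ε : ℝ≥0∞) (R : ℝ) : Prop :=
  0 ≤ R ∧ ∃ (M : ℕ → ℕ) (e : ℕ → ℝ≥0∞),
    (∀ n, HasGPCode (W n) (PS n) (M n) (e n)) ∧
    (R : EReal) ≤ liminf (fun n : ℕ => ((Real.log (M n) / n : ℝ) : EReal)) atTop ∧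
    limsup e atTop ≤ ε

/-- The `ε`-capacity: the supremum of all `ε`-achievable rates. -/
def epsCapacity (W : ∀ n : ℕ, Kernel ((Fin n → 𝒳) × (Fin n → 𝒮)) (Fin n → 𝒴))
    (PS : ∀ n : ℕ, Measure (Fin n → 𝒮)) (ε : ℝ≥0∞) : EReal :=
  sSup {r : EReal | ∃ R : ℝ, IsAchievableRate W PS ε R ∧ r = (R : EReal)}

/-- `P n` is, for each `n`, a joint law of `((Uⁿ, (Xⁿ, Sⁿ)), Yⁿ)` with the given state law, in which
`Uⁿ - (Xⁿ, Sⁿ) - Yⁿ` is a Markov chain and `Yⁿ` given `(Xⁿ, Sⁿ)` has the conditional law `Wⁿ`.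
The field `input` says that `Xⁿ` has a (regular) conditional law given `(Uⁿ, Sⁿ)`; this is automatic
for standard Borel input alphabets, see `exists_input_kernel`. -/
structure IsGPProcess (W : ∀ n : ℕ, Kernel ((Fin n → 𝒳) × (Fin n → 𝒮)) (Fin n → 𝒴))
    (PS : ∀ n : ℕ, Measure (Fin n → 𝒮)) {𝒰 : Type v} [MeasurableSpace 𝒰]
    (P : ∀ n : ℕ, Measure (((Fin n → 𝒰) × ((Fin n → 𝒳) × (Fin n → 𝒮))) × (Fin n → 𝒴))) :
    Prop where
  prob : ∀ n, IsProbabilityMeasure (P n)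
  state : ∀ n, (P n).map (fun ω => ω.1.2.2) = PS n
  channel : ∀ n, P n = (P n).fst.compProd ((W n).prodMkLeft (Fin n → 𝒰))
  input : ∀ n, ∃ K : Kernel ((Fin n → 𝒰) × (Fin n → 𝒮)) (Fin n → 𝒳), IsMarkovKernel K ∧
    (P n).map (fun ω => ((ω.1.1, ω.1.2.2), ω.1.2.1)) =
      ((P n).map (fun ω => (ω.1.1, ω.1.2.2))).compProd K

theorem exists_input_kernel [StandardBorelSpace 𝒳] [Nonempty 𝒳] {𝒰 : Type v} [MeasurableSpace 𝒰]
    {n : ℕ} (P : Measure (((Fin n → 𝒰) × ((Fin n → 𝒳) × (Fin n → 𝒮))) × (Fin n → 𝒴)))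
    [IsProbabilityMeasure P] :
    ∃ K : Kernel ((Fin n → 𝒰) × (Fin n → 𝒮)) (Fin n → 𝒳), IsMarkovKernel K ∧
      P.map (fun ω => ((ω.1.1, ω.1.2.2), ω.1.2.1)) =
        (P.map (fun ω => (ω.1.1, ω.1.2.2))).compProd K :=
  ⟨condDistrib (fun ω => ω.1.2.1) (fun ω => (ω.1.1, ω.1.2.2)) P, inferInstance,
    (compProd_map_condDistrib (by fun_prop)).symm⟩

/-- The supremum of `I_(U;Y) - Ī(U;S)` over all auxiliary alphabets `𝒰` and all admissible
processes. In `EReal`, `⊤ - ⊤ = ⊥`, so processes with `Ī(U;S) = +∞` do not contribute. -/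
def gpFormula (W : ∀ n : ℕ, Kernel ((Fin n → 𝒳) × (Fin n → 𝒮)) (Fin n → 𝒴))
    (PS : ∀ n : ℕ, Measure (Fin n → 𝒮)) : EReal :=
  sSup {r : EReal | ∃ (𝒰 : Type v) (_ : MeasurableSpace 𝒰)
    (P : ∀ n : ℕ, Measure (((Fin n → 𝒰) × ((Fin n → 𝒳) × (Fin n → 𝒮))) × (Fin n → 𝒴))),
    IsGPProcess W PS P ∧
    r = spectralInfMI (fun n => (P n).map (fun ω => (ω.1.1, ω.2))) -
        spectralSupMI (fun n => (P n).map (fun ω => (ω.1.1, ω.1.2.2)))}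

end GelfandPinsker

end

/-! ### Change of measure through the information density. -/

section InformationDensity

variable {A B : Type*} [MeasurableSpace A] [MeasurableSpace B]

/-! Direct part: random coding with binning. Draw `M` bins of `L` codewords i.i.d. from the law of
U. The encoder searches the bin of its message for a `u` with `(u, s)` in a good set `G`; the
decoder searches for a bin holding a `u` with i(u;y) > β. By change of measure
(`measure_le_of_infoDensity_le`), slightly more than exp(n Ī(U;S)) codewords per bin suffice to
serve most states, while a wrong codeword passes the decoder's test with probability at most
exp(-β), so that `M * L` may come close to exp(n I_(U;Y)). The quotient is the rate. No conditional
typicality argument is needed: `G` keeps only pairs whose output fails the test with conditional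
probability at most θ, and Markov's inequality bounds what is lost. Since C_ε is wanted only for ε >
0, θ may stay fixed (`exists_code_of_joint_law`, `isAchievableRate_of_lt`).

Converse: let U be the message itself and X the output of the randomized encoder. U is independent
of the state, so Ī(U;S) ≤ 0, and the Verdú–Han bound (`measure_infoDensity_le_le`) gives I_(U;Y) ≥ R
as soon as the errors vanish. At a rate below every C_ε they can be made to vanish, because the
optimal error at each blocklength has limsup at most ε for every ε > 0. As C_ε is monotone in ε, its
right limit at 0 is its infimum. -/

lemma measurable_infoDensity (P : Measure (A × B)) : Measurable (infoDensity P) :=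
  ENNReal.measurable_log.comp ((Measure.measurable_rnDeriv _ _).div (Measure.measurable_rnDeriv _ _))

lemma ENNReal.log_le_coe_iff {x : ℝ≥0∞} {r : ℝ} :
    ENNReal.log x ≤ (r : EReal) ↔ x ≤ ENNReal.ofReal (Real.exp r) := by
  rw [← EReal.exp_coe, ← ENNReal.log_le_log_iff, EReal.log_exp]

/-- Densities are taken with respect to `P + ν`, so the pointwise bound p ≤ exp(r) q can be
integrated over `E` without assuming P ≪ P_A × P_B. -/
lemma measure_le_of_infoDensity_le (P : Measure (A × B)) [IsProbabilityMeasure P] {r : ℝ}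
    {E : Set (A × B)} (hE : MeasurableSet E) (h : ∀ z ∈ E, infoDensity P z ≤ (r : EReal)) :
    P E ≤ ENNReal.ofReal (Real.exp r) * (P.fst.prod P.snd) E := by
  set ν := P.fst.prod P.snd with hν
  have h1 : P ≪ P + ν := (Measure.le_add_right le_rfl).absolutelyContinuous
  have h2 : ν ≪ P + ν := (Measure.le_add_left le_rfl).absolutelyContinuous
  have hc : ENNReal.ofReal (Real.exp r) ≠ 0 := by simp [Real.exp_pos]
  rw [← Measure.setLIntegral_rnDeriv h1, ← Measure.setLIntegral_rnDeriv h2,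
    ← lintegral_const_mul _ (Measure.measurable_rnDeriv _ _)]
  refine setLIntegral_mono' hE fun z hz => ?_
  have := ENNReal.log_le_coe_iff.1 (h z hz)
  exact (ENNReal.div_le_iff_le_mul (Or.inr ENNReal.ofReal_ne_top) (Or.inr hc)).1 this

lemma mul_measure_le_of_lt_infoDensity (P : Measure (A × B)) [IsProbabilityMeasure P] {r : ℝ}
    {E : Set (A × B)} (hE : MeasurableSet E) (h : ∀ z ∈ E, (r : EReal) < infoDensity P z) :
    ENNReal.ofReal (Real.exp r) * (P.fst.prod P.snd) E ≤ P E := by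
  set ν := P.fst.prod P.snd with hν
  have h1 : P ≪ P + ν := (Measure.le_add_right le_rfl).absolutelyContinuous
  have h2 : ν ≪ P + ν := (Measure.le_add_left le_rfl).absolutelyContinuous
  rw [← Measure.setLIntegral_rnDeriv h1, ← Measure.setLIntegral_rnDeriv h2,
    ← lintegral_const_mul _ (Measure.measurable_rnDeriv _ _)]
  refine setLIntegral_mono' hE fun z hz => ?_
  have := ENNReal.log_le_coe_iff.not.1 (h z hz).not_ge
  exact ENNReal.mul_le_of_le_div (not_le.1 this).le

lemma infoDensity_ae_eq_zero_of_eq_prod (P : Measure (A × B)) [IsProbabilityMeasure P]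
    (h : P = P.fst.prod P.snd) : ∀ᵐ z ∂P, infoDensity P z = 0 := by
  have h1 : P ≪ P + P := (Measure.le_add_right le_rfl).absolutelyContinuous
  have h2 := Measure.rnDeriv_pos h1
  have h3 := h1 (Measure.rnDeriv_ne_top P (P + P))
  filter_upwards [h2, h3] with z hz hz'
  unfold infoDensity
  rw [← h, ENNReal.div_self hz.ne' hz', ENNReal.log_one]

end InformationDensity

/-! ### Limits superior and inferior in probability. -/

section LimitsInProbability

variable {Ω : ℕ → Type*} [∀ n, MeasurableSpace (Ω n)] {P : ∀ n, Measure (Ω n)}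
  {Z : ∀ n, Ω n → EReal}

lemma tendsto_measure_of_pLimsup_lt {α : EReal} (h : pLimsup P Z < α) :
    Tendsto (fun n => P n {ω | α ≤ Z n ω}) atTop (𝓝 0) := by
  obtain ⟨α', h', hlt⟩ := sInf_lt_iff.1 h
  exact tendsto_of_tendsto_of_tendsto_of_le_of_le tendsto_const_nhds h' (fun _ => zero_le)
    fun n => measure_mono fun ω hω => lt_of_lt_of_le hlt hω

lemma tendsto_measure_of_lt_pLiminf {α : EReal} (h : α < pLiminf P Z) :
    Tendsto (fun n => P n {ω | Z n ω ≤ α}) atTop (𝓝 0) := by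
  have := tendsto_measure_of_pLimsup_lt (EReal.lt_neg_comm.1 h)
  simpa only [EReal.neg_le_neg_iff] using this

lemma pLimsup_le {α : EReal} (h : Tendsto (fun n => P n {ω | α < Z n ω}) atTop (𝓝 0)) :
    pLimsup P Z ≤ α :=
  sInf_le h

lemma le_pLiminf {α : EReal} (h : Tendsto (fun n => P n {ω | Z n ω < α}) atTop (𝓝 0)) :
    α ≤ pLiminf P Z := by
  refine EReal.le_neg_of_le_neg (pLimsup_le ?_)
  simpa only [EReal.neg_lt_neg_iff] using h

end LimitsInProbability

/-! ### Spectral information rates. -/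

section SpectralRates

variable {A B : ℕ → Type*} [∀ n, MeasurableSpace (A n)] [∀ n, MeasurableSpace (B n)]
  {P : ∀ n, Measure (A n × B n)}

lemma EReal.div_natCast_le_coe_iff {x : EReal} {n : ℕ} (hn : 0 < n) {r : ℝ} :
    x / (n : EReal) ≤ (r : EReal) ↔ x ≤ ((n * r : ℝ) : EReal) := by
  rw [EReal.div_le_iff_le_mul (by exact_mod_cast hn) (EReal.natCast_ne_top n)]
  norm_cast

lemma tendsto_ofReal_exp_neg_mul {r : ℝ} (hr : 0 < r) :
    Tendsto (fun n : ℕ => ENNReal.ofReal (Real.exp (-(n * r)))) atTop (𝓝 0) := by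
  rw [← ENNReal.ofReal_zero]
  exact ENNReal.tendsto_ofReal (Real.tendsto_exp_neg_atTop_nhds_zero.comp
    (tendsto_natCast_atTop_atTop.atTop_mul_const hr))

/-- For r < 0, change of measure gives density at most nr only probability exp(nr). If the rate were
below r, the opposite event would vanish too, and the two events cover the space. -/
lemma spectralSupMI_nonneg [∀ n, IsProbabilityMeasure (P n)] : 0 ≤ spectralSupMI P := by
  by_contra! h
  obtain ⟨r, hr, hr0⟩ := EReal.lt_iff_exists_real_btwn.1 h
  have hr0' : 0 < -r := by simpa using (by exact_mod_cast hr0 : r < 0)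
  have h1 := tendsto_measure_of_pLimsup_lt hr
  have h2 := h1.add (tendsto_ofReal_exp_neg_mul hr0')
  rw [add_zero] at h2
  refine absurd (ge_of_tendsto h2 ?_) (by simp : ¬ (1 : ℝ≥0∞) ≤ 0)
  filter_upwards [eventually_gt_atTop 0] with n hn
  have hm : MeasurableSet {z | infoDensity (P n) z / (n : EReal) ≤ (r : EReal)} := by
    simp_rw [EReal.div_natCast_le_coe_iff hn]
    exact measurableSet_le (measurable_infoDensity _) measurable_const
  have h3 := measure_le_of_infoDensity_le (P n) hm
    (fun z hz => (EReal.div_natCast_le_coe_iff hn).1 hz)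
  calc (1 : ℝ≥0∞) = P n Set.univ := measure_univ.symm
    _ ≤ P n ({z | (r : EReal) ≤ infoDensity (P n) z / (n : EReal)} ∪
        {z | infoDensity (P n) z / (n : EReal) ≤ (r : EReal)}) :=
        measure_mono fun z _ => by simpa using le_total _ _
    _ ≤ _ := measure_union_le _ _
    _ ≤ _ := by
        gcongr
        refine h3.trans ?_
        rw [mul_neg, neg_neg]
        exact mul_le_of_le_one_right (zero_le) prob_le_one

end SpectralRates

/-! ### Random coding with binning, for abstract test sets. -/

section RandomCoding

lemma exists_measurable_index {Ω : Type*} [MeasurableSpace Ω] {L : ℕ} (hL : 0 < L)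
    (A : Fin L → Set Ω) (hA : ∀ l, MeasurableSet (A l)) :
    ∃ i : Ω → Fin L, Measurable i ∧ ∀ ω, (∃ l, ω ∈ A l) → ω ∈ A (i ω) := by
  classical
  -- The alternative `L ≤ k` makes the search for the least index total; its value is then replaced
  -- by index 0.
  have hp : ∀ ω, ∃ k, (∃ h : k < L, ω ∈ A ⟨k, h⟩) ∨ L ≤ k := fun ω => ⟨L, Or.inr le_rfl⟩
  have hm : Measurable fun ω => Nat.find (hp ω) := by
    refine measurable_find hp fun k => ?_
    by_cases hk : k < L
    · simpa [hk, hk.not_ge] using hA ⟨k, hk⟩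
    · simp [hk, not_lt.1 hk]
  refine ⟨fun ω => if h : Nat.find (hp ω) < L then ⟨Nat.find (hp ω), h⟩ else ⟨0, hL⟩,
    (measurable_from_nat (f := fun k => if h : k < L then (⟨k, h⟩ : Fin L) else ⟨0, hL⟩)).comp hm,
    ?_⟩
  rintro ω ⟨l, hl⟩
  have hlt : Nat.find (hp ω) < L :=
    (Nat.find_min' (hp ω) (Or.inl ⟨l.2, hl⟩)).trans_lt l.2
  beta_reduce
  rw [dif_pos hlt]
  rcases Nat.find_spec (hp ω) with ⟨_, h⟩ | h
  · exact h
  · omega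

lemma measurable_eval_index {Ω U : Type*} [MeasurableSpace Ω] [MeasurableSpace U] {L : ℕ}
    {i : Ω → Fin L} (hi : Measurable i) {g : Ω → Fin L → U} (hg : Measurable g) :
    Measurable fun ω => g ω (i ω) :=
  (measurable_from_prod_countable_left (f := fun p : (Fin L → U) × Fin L => p.1 p.2)
    fun l => measurable_pi_apply l).comp (hg.prodMk hi)

variable {U S X Y : Type*} [MeasurableSpace U] [MeasurableSpace S] [MeasurableSpace X]
  [MeasurableSpace Y]

/-- The law of the output given `(u, s)` if the input is drawn from `K (u, s)`. -/
noncomputable def outputKernel (K : Kernel (U × S) X) (W : Kernel (X × S) Y) : Kernel (U × S) Y :=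
  Kernel.snd (K ⊗ₖ W.comap (fun p : (U × S) × X => (p.2, p.1.2)) (by fun_prop))

instance (K : Kernel (U × S) X) (W : Kernel (X × S) Y) [IsMarkovKernel K] [IsMarkovKernel W] :
    IsMarkovKernel (outputKernel K W) := by
  unfold outputKernel; infer_instance

lemma outputKernel_apply (K : Kernel (U × S) X) (W : Kernel (X × S) Y) [IsMarkovKernel K]
    [IsMarkovKernel W] (p : U × S) {A : Set Y} (hA : MeasurableSet A) :
    outputKernel K W p A = ∫⁻ x, W (x, p.2) A ∂(K p) := by
  rw [outputKernel, Kernel.snd_apply' _ _ hA, Kernel.compProd_apply (measurable_snd hA)]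
  rfl

/-- The law of the output given a codebook `a`, if `sel (a, s)` is transmitted in the state `s`. -/
noncomputable def codebookKernel {T : Type*} [MeasurableSpace T] (V : Kernel (U × S) Y)
    (PS : Measure S) (sel : T × S → U) (hsel : Measurable sel) : Kernel T Y :=
  Kernel.snd (Kernel.const T PS ⊗ₖ V.comap (fun p : T × S => (sel p, p.2)) (by fun_prop))

instance {T : Type*} [MeasurableSpace T] (V : Kernel (U × S) Y) [IsMarkovKernel V]
    (PS : Measure S) [IsProbabilityMeasure PS] (sel : T × S → U) (hsel : Measurable sel) :
    IsMarkovKernel (codebookKernel V PS sel hsel) := by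
  unfold codebookKernel; infer_instance

lemma codebookKernel_apply {T : Type*} [MeasurableSpace T] (V : Kernel (U × S) Y)
    [IsMarkovKernel V] (PS : Measure S) [IsProbabilityMeasure PS] (sel : T × S → U)
    (hsel : Measurable sel) (t : T) {A : Set Y} (hA : MeasurableSet A) :
    codebookKernel V PS sel hsel t A = ∫⁻ s, V (sel (t, s), s) A ∂PS := by
  rw [codebookKernel, Kernel.snd_apply' _ _ hA, Kernel.compProd_apply (measurable_snd hA)]
  rfl

lemma lintegral_pi_eval_pair {T : Type*} [MeasurableSpace T] (Q : Measure T)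
    [IsProbabilityMeasure Q] {M : ℕ} {m m' : Fin M} (h : m ≠ m') {F : T × T → ℝ≥0∞}
    (hF : Measurable F) :
    ∫⁻ c, F (c m, c m') ∂(Measure.pi fun _ : Fin M => Q) = ∫⁻ p, F p ∂(Q.prod Q) := by
  have hi := (iIndepFun_pi (μ := fun _ : Fin M => Q) (X := fun _ => id)
    (fun _ => aemeasurable_id)).indepFun h
  have h1 := (indepFun_iff_map_prod_eq_prod_map_map (measurable_pi_apply m).aemeasurable
    (measurable_pi_apply m').aemeasurable).1 hi
  have he : ∀ j : Fin M, (Measure.pi fun _ : Fin M => Q).map (fun c => c j) = Q := fun j =>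
    (measurePreserving_eval (fun _ : Fin M => Q) j).map_eq
  rw [he, he] at h1
  rw [← h1, lintegral_map hF (by fun_prop)]

/-- False alarms: the codewords of a wrong bin are drawn independently of the output, so after
Fubini a union bound over the bin applies for each fixed `y`. -/
lemma lintegral_measure_exists_le (PU : Measure U) [IsProbabilityMeasure PU] {L : ℕ}
    (μ : Measure Y) [IsProbabilityMeasure μ] {T : Set (U × Y)} (hT : MeasurableSet T) {δ : ℝ≥0∞}
    (hδ : ∀ y, PU {u | (u, y) ∈ T} ≤ δ) :
    ∫⁻ b, μ {y | ∃ l, (b l, y) ∈ T} ∂(Measure.pi fun _ : Fin L => PU) ≤ L * δ := by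
  set Q := Measure.pi fun _ : Fin L => PU
  have hE : MeasurableSet {p : (Fin L → U) × Y | ∃ l, (p.1 l, p.2) ∈ T} := by
    simp only [Set.ofPred_exists]
    exact MeasurableSet.iUnion fun l =>
      hT.preimage (f := fun p : (Fin L → U) × Y => (p.1 l, p.2)) (by fun_prop)
  calc ∫⁻ b, μ {y | ∃ l, (b l, y) ∈ T} ∂Q
      = (Q.prod μ) {p | ∃ l, (p.1 l, p.2) ∈ T} := (Measure.prod_apply hE).symm
    _ = ∫⁻ y, Q {b | ∃ l, (b l, y) ∈ T} ∂μ := Measure.prod_apply_symm hE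
    _ ≤ ∫⁻ _, L * δ ∂μ := by
        refine lintegral_mono fun y => ?_
        simp only [Set.ofPred_exists]
        refine (measure_iUnion_le _).trans ?_
        rw [tsum_fintype]
        refine (Finset.sum_le_sum (g := fun _ => δ) fun l _ => ?_).trans (by simp)
        have hy : MeasurableSet {u | (u, y) ∈ T} := hT.preimage (by fun_prop)
        exact ((measurePreserving_eval (fun _ : Fin L => PU) l).measure_preimage
          hy.nullMeasurableSet).le.trans (hδ y)
    _ = L * δ := by simp

lemma lintegral_measure_forall_notMem (PU : Measure U) [IsProbabilityMeasure PU] {L : ℕ}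
    (μ : Measure S) [IsProbabilityMeasure μ] {G : Set (U × S)} (hG : MeasurableSet G) :
    ∫⁻ a, μ {s | ∀ l, (a l, s) ∉ G} ∂(Measure.pi fun _ : Fin L => PU) =
      ∫⁻ s, PU {u | (u, s) ∉ G} ^ L ∂μ := by
  set Q := Measure.pi fun _ : Fin L => PU
  have hE : MeasurableSet {p : (Fin L → U) × S | ∀ l, (p.1 l, p.2) ∉ G} := by
    simp only [Set.ofPred_forall]
    exact MeasurableSet.iInter fun l =>
      hG.compl.preimage (f := fun p : (Fin L → U) × S => (p.1 l, p.2)) (by fun_prop)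
  calc ∫⁻ a, μ {s | ∀ l, (a l, s) ∉ G} ∂Q
      = (Q.prod μ) {p | ∀ l, (p.1 l, p.2) ∉ G} := (Measure.prod_apply hE).symm
    _ = ∫⁻ s, Q {a | ∀ l, (a l, s) ∉ G} ∂μ := Measure.prod_apply_symm hE
    _ = _ := by
        congr 1 with s
        have : {a : Fin L → U | ∀ l, (a l, s) ∉ G} = Set.univ.pi fun _ => {u | (u, s) ∉ G} := by
          ext a; simp
        rw [this, Measure.pi_pi]
        simp

/-- Random coding with binning: the encoder looks for a codeword of the bin of the message that is
compatible with the state, the decoder for a bin with a codeword that is compatible with the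
output. -/
theorem exists_code_of_random_coding (PU : Measure U) [IsProbabilityMeasure PU] (PS : Measure S)
    [IsProbabilityMeasure PS] (K : Kernel (U × S) X) [IsMarkovKernel K] (W : Kernel (X × S) Y)
    [IsMarkovKernel W] {G : Set (U × S)} (hG : MeasurableSet G) {T : Set (U × Y)}
    (hT : MeasurableSet T) {θ δ : ℝ≥0∞}
    (hθ : ∀ p ∈ G, outputKernel K W p {y | (p.1, y) ∉ T} ≤ θ)
    (hδ : ∀ y, PU {u | (u, y) ∈ T} ≤ δ) {M L : ℕ} (hM : 0 < M) (hL : 0 < L) :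
    ∃ (enc : Fin M → Kernel S X) (dec : Y → Fin M), (∀ m, IsMarkovKernel (enc m)) ∧
      Measurable dec ∧
      (M : ℝ≥0∞)⁻¹ * ∑ m : Fin M, ∫⁻ s, ∫⁻ x, W (x, s) {y | dec y ≠ m} ∂(enc m s) ∂PS ≤
        ∫⁻ s, PU {u | (u, s) ∉ G} ^ L ∂PS + θ + M * (L * δ) := by
  classical
  set V := outputKernel K W
  set Q := Measure.pi fun _ : Fin L => PU with hQ
  obtain ⟨idx, hidx, hidxG⟩ := exists_measurable_index hL
    (fun l => {p : (Fin L → U) × S | (p.1 l, p.2) ∈ G}) (fun l => hG.preimage (by fun_prop))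
  set sel : (Fin L → U) × S → U := fun p => p.1 (idx p)
  have hsel : Measurable sel := measurable_eval_index hidx measurable_fst
  set Z := codebookKernel V PS sel hsel
  have hTb : ∀ b : Fin L → U, MeasurableSet {y | ∃ l, (b l, y) ∈ T} := fun b => by
    simp only [Set.ofPred_exists]
    exact MeasurableSet.iUnion fun l => hT.preimage (by fun_prop)
  set F : (Fin L → U) × (Fin L → U) → ℝ≥0∞ := fun p => Z p.1 {y | ∃ l, (p.2 l, y) ∈ T}
  have hF : Measurable F := by
    have hE : MeasurableSet
        {q : ((Fin L → U) × (Fin L → U)) × Y | ∃ l, (q.1.2 l, q.2) ∈ T} := by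
      simp only [Set.ofPred_exists]
      exact MeasurableSet.iUnion fun l => hT.preimage
        (f := fun q : ((Fin L → U) × (Fin L → U)) × Y => (q.1.2 l, q.2)) (by fun_prop)
    exact Kernel.measurable_kernel_prodMk_left (κ := Z.prodMkRight (Fin L → U)) hE
  set N : (Fin L → U) → ℝ≥0∞ := fun a => PS {s | ∀ l, (a l, s) ∉ G}
  have hN : Measurable N := by
    have hE : MeasurableSet {p : (Fin L → U) × S | ∀ l, (p.1 l, p.2) ∉ G} := by
      simp only [Set.ofPred_forall]
      exact MeasurableSet.iInter fun l =>
        hG.compl.preimage (f := fun p : (Fin L → U) × S => (p.1 l, p.2)) (by fun_prop)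
    exact measurable_measure_prodMk_left hE
  -- This explicit upper bound is averaged over codebooks in place of the error itself, so the
  -- decoder need not depend measurably on the codebook.
  set Bd : (Fin M → Fin L → U) → ℝ≥0∞ := fun c => (M : ℝ≥0∞)⁻¹ * ∑ m : Fin M,
    (N (c m) + θ + ∑ m' ∈ Finset.univ.filter (· ≠ m), F (c m, c m'))
  have hBd : Measurable Bd := by fun_prop
  have hmean : ∫⁻ c, Bd c ∂(Measure.pi fun _ : Fin M => Q) ≤
      ∫⁻ s, PU {u | (u, s) ∉ G} ^ L ∂PS + θ + M * (L * δ) := by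
    rw [lintegral_const_mul _ (by fun_prop), lintegral_finsetSum _ (fun m _ => by fun_prop)]
    have : ∀ m : Fin M, ∫⁻ c, (N (c m) + θ + ∑ m' ∈ Finset.univ.filter (· ≠ m), F (c m, c m'))
        ∂(Measure.pi fun _ : Fin M => Q) ≤
        ∫⁻ s, PU {u | (u, s) ∉ G} ^ L ∂PS + θ + M * (L * δ) := fun m => by
      rw [lintegral_add_left (by fun_prop), lintegral_add_right _ measurable_const,
        lintegral_finsetSum _ (fun m _ => by fun_prop), lintegral_const, measure_univ, mul_one,
        (measurePreserving_eval (fun _ : Fin M => Q) m).lintegral_comp hN,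
        lintegral_measure_forall_notMem PU PS hG]
      gcongr
      refine (Finset.sum_le_sum (g := fun _ => L * δ) fun m' hm' => ?_).trans ?_
      · rw [lintegral_pi_eval_pair Q (by simpa using (Finset.mem_filter.1 hm').2.symm) hF,
          lintegral_prod _ hF.aemeasurable]
        refine (lintegral_mono fun a => lintegral_measure_exists_le PU (Z a) hT hδ).trans ?_
        simp
      · rw [Finset.sum_const, nsmul_eq_mul]
        gcongr
        exact (Finset.card_le_univ _).trans (by simp)
    refine (mul_le_mul_right (Finset.sum_le_sum fun m _ => this m) _).trans ?_
    rw [Finset.sum_const, nsmul_eq_mul, Finset.card_univ, Fintype.card_fin, ← mul_assoc,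
      ENNReal.inv_mul_cancel (by exact_mod_cast hM.ne') (ENNReal.natCast_ne_top M), one_mul]
  obtain ⟨c, hc⟩ := exists_le_lintegral (μ := Measure.pi fun _ : Fin M => Q) hBd.aemeasurable
  obtain ⟨dec, hdec, hdecT⟩ := exists_measurable_index hM
    (fun m => {y | ∃ l, (c m l, y) ∈ T}) (fun m => hTb (c m))
  refine ⟨fun m => K.comap (fun s => (sel (c m, s), s)) (by fun_prop), dec, fun m => inferInstance,
    hdec, le_trans ?_ (hc.trans hmean)⟩
  refine mul_le_mul_right (Finset.sum_le_sum fun m _ => ?_) _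
  have hD : MeasurableSet {y | dec y ≠ m} := (hdec (measurableSet_singleton m)).compl
  have hNm : MeasurableSet {s | ∀ l, (c m l, s) ∉ G} := by
    simp only [Set.ofPred_forall]
    exact MeasurableSet.iInter fun l => hG.compl.preimage (by fun_prop)
  set R : Set Y := ⋃ m' ∈ Finset.univ.filter (· ≠ m), {y | ∃ l, (c m' l, y) ∈ T}
  have hR : MeasurableSet R := Finset.measurableSet_biUnion _ fun m' _ => hTb (c m')
  -- If the true bin accepts `y`, some bin does, hence the decoded bin accepts it as well; an error
  -- then means that a wrong bin accepts.
  have hsub : ∀ u l, u = c m l → {y | dec y ≠ m} ⊆ {y | (u, y) ∉ T} ∪ R := by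
    rintro u l rfl y hy
    by_cases hy' : (c m l, y) ∈ T
    · refine Or.inr (Set.mem_iUnion₂.2 ⟨dec y, by simpa using hy, hdecT y ⟨m, l, hy'⟩⟩)
    · exact Or.inl hy'
  have hmV : Measurable fun s => V (sel (c m, s), s) R :=
    (Kernel.measurable_coe V hR).comp (by fun_prop)
  calc ∫⁻ s, ∫⁻ x, W (x, s) {y | dec y ≠ m} ∂(K.comap (fun s => (sel (c m, s), s)) _ s) ∂PS
      = ∫⁻ s, V (sel (c m, s), s) {y | dec y ≠ m} ∂PS := by
        congr 1 with s
        rw [outputKernel_apply K W _ hD]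
        rfl
    _ ≤ ∫⁻ s, (Set.indicator {s | ∀ l, (c m l, s) ∉ G} 1 s + θ + V (sel (c m, s), s) R) ∂PS := by
        refine lintegral_mono fun s => ?_
        by_cases hs : s ∈ {s | ∀ l, (c m l, s) ∉ G}
        · rw [Set.indicator_of_mem hs]
          exact prob_le_one.trans (by rw [add_assoc]; exact le_self_add)
        · have hs' : ∃ l, (c m l, s) ∈ G := by simpa using hs
          have h1 : (sel (c m, s), s) ∈ G := hidxG (c m, s) hs'
          refine (measure_mono (hsub _ (idx (c m, s)) rfl)).trans ((measure_union_le _ _).trans ?_)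
          gcongr
          exact (hθ _ h1).trans le_add_self
    _ = N (c m) + θ + Z (c m) R := by
        rw [lintegral_add_right _ hmV, lintegral_add_right _ measurable_const,
          lintegral_indicator_one hNm, lintegral_const, measure_univ, mul_one,
          codebookKernel_apply V PS sel hsel (c m) hR]
    _ ≤ _ := by
        gcongr
        exact measure_biUnion_finset_le _ _

end RandomCoding

/-! ### One-shot achievability for a given joint law. -/

section OneShot

variable {U S X Y : Type*} [MeasurableSpace U] [MeasurableSpace S] [MeasurableSpace X]
  [MeasurableSpace Y]

/-- Covering: split the states by whether their section of `G` has mass at most `t`. Good sections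
miss all `L` codewords with probability at most (1 - t)^L; the bad states carry little mass by
change of measure on `G`. -/
lemma lintegral_pow_le_of_infoDensity_le (P : Measure (U × S)) [IsProbabilityMeasure P] {r : ℝ}
    {G : Set (U × S)} (hG : MeasurableSet G) (h : ∀ z ∈ G, infoDensity P z ≤ (r : EReal))
    (t : ℝ≥0∞) (L : ℕ) :
    ∫⁻ s, P.fst {u | (u, s) ∉ G} ^ L ∂P.snd ≤
      P Gᶜ + ENNReal.ofReal (Real.exp r) * t + (1 - t) ^ L := by
  have hm : Measurable fun s => P.fst {u | (u, s) ∈ G} := measurable_measure_prodMk_right hG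
  set C : Set S := {s | P.fst {u | (u, s) ∈ G} ≤ t}
  have hC : MeasurableSet C := measurableSet_le hm measurable_const
  have hGC : MeasurableSet (G ∩ Prod.snd ⁻¹' C) := hG.inter (measurable_snd hC)
  have h1 : (P.fst.prod P.snd) (G ∩ Prod.snd ⁻¹' C) ≤ t := by
    rw [Measure.prod_apply_symm hGC]
    refine (lintegral_mono (g := fun _ => t) fun s => ?_).trans (by simp)
    by_cases hs : s ∈ C
    · exact (measure_mono fun u hu => hu.1).trans hs
    · have : (fun u => (u, s)) ⁻¹' (G ∩ Prod.snd ⁻¹' C) = ∅ := by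
        ext u; simp [hs]
      simp [this]
  have h2 : P.snd C ≤ P Gᶜ + ENNReal.ofReal (Real.exp r) * t := by
    rw [Measure.snd_apply hC]
    calc P (Prod.snd ⁻¹' C) ≤ P (Gᶜ ∪ G ∩ Prod.snd ⁻¹' C) := by
          refine measure_mono fun z hz => ?_
          by_cases hzG : z ∈ G
          · exact Or.inr ⟨hzG, hz⟩
          · exact Or.inl hzG
      _ ≤ P Gᶜ + P (G ∩ Prod.snd ⁻¹' C) := measure_union_le _ _
      _ ≤ _ := by
          gcongr
          exact (measure_le_of_infoDensity_le P hGC fun z hz => h z hz.1).trans (by gcongr)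
  calc ∫⁻ s, P.fst {u | (u, s) ∉ G} ^ L ∂P.snd
      ≤ ∫⁻ s, (C.indicator 1 s + (1 - t) ^ L) ∂P.snd := by
        refine lintegral_mono fun s => ?_
        by_cases hs : s ∈ C
        · rw [Set.indicator_of_mem hs]
          exact (pow_le_one₀ zero_le prob_le_one).trans le_self_add
        · rw [Set.indicator_of_notMem hs, zero_add]
          gcongr
          have hGs : MeasurableSet {u | (u, s) ∈ G} := hG.preimage (by fun_prop)
          have hcompl : {u | (u, s) ∉ G} = {u | (u, s) ∈ G}ᶜ := rfl
          rw [hcompl, prob_compl_eq_one_sub hGs]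
          exact tsub_le_tsub_left (not_le.1 hs).le _
    _ = P.snd C + (1 - t) ^ L := by
        rw [lintegral_add_right _ measurable_const, lintegral_indicator_one hC]
        simp
    _ ≤ _ := by gcongr

/-- Integrated over any set `C` of outputs, the claim is the change of measure exp(r) (P_U × P_Y)(E)
≤ P(E) ≤ P_Y(C), with `E` the part of the event above `C`. -/
lemma ae_measure_lt_infoDensity_le (P : Measure (U × Y)) [IsProbabilityMeasure P] (r : ℝ) :
    ∀ᵐ y ∂P.snd, P.fst {u | (r : EReal) < infoDensity P (u, y)} ≤
      ENNReal.ofReal (Real.exp (-r)) := by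
  have hT : MeasurableSet {z | (r : EReal) < infoDensity P z} :=
    measurableSet_lt measurable_const (measurable_infoDensity P)
  refine ae_le_of_forall_setLIntegral_le_of_sigmaFinite (measurable_measure_prodMk_right hT)
    fun C hC _ => ?_
  have hTC : MeasurableSet ({z | (r : EReal) < infoDensity P z} ∩ Prod.snd ⁻¹' C) :=
    hT.inter (measurable_snd hC)
  have h1 : ∫⁻ y in C, P.fst {u | (r : EReal) < infoDensity P (u, y)} ∂P.snd =
      (P.fst.prod P.snd) ({z | (r : EReal) < infoDensity P z} ∩ Prod.snd ⁻¹' C) := by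
    rw [Measure.prod_apply_symm hTC, ← lintegral_indicator hC]
    congr 1 with y
    by_cases hy : y ∈ C
    · rw [Set.indicator_of_mem hy]
      congr 1 with u
      simp [hy]
    · rw [Set.indicator_of_notMem hy]
      have : (fun u => (u, y)) ⁻¹' ({z | (r : EReal) < infoDensity P z} ∩ Prod.snd ⁻¹' C) = ∅ := by
        ext u; simp [hy]
      simp [this]
  have h2 := mul_measure_le_of_lt_infoDensity P hTC fun z hz => hz.1
  rw [h1, setLIntegral_const, Real.exp_neg, ENNReal.ofReal_inv_of_pos (Real.exp_pos r),
    Measure.snd_apply hC, mul_comm, ← div_eq_mul_inv]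
  rw [ENNReal.le_div_iff_mul_le (Or.inl (by simp [Real.exp_pos])) (Or.inl ENNReal.ofReal_ne_top),
    mul_comm]
  exact h2.trans (measure_mono Set.inter_subset_right)

lemma map_output_apply {P : Measure ((U × (X × S)) × Y)} [IsProbabilityMeasure P]
    {W : Kernel (X × S) Y} [IsMarkovKernel W] {K : Kernel (U × S) X} [IsMarkovKernel K]
    (channel : P = P.fst.compProd (W.prodMkLeft U))
    (input : P.map (fun ω => ((ω.1.1, ω.1.2.2), ω.1.2.1)) =
      (P.map (fun ω => (ω.1.1, ω.1.2.2))).compProd K)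
    {E : Set (U × Y)} (hE : MeasurableSet E) :
    P.map (fun ω => (ω.1.1, ω.2)) E =
      ∫⁻ p, outputKernel K W p {y | (p.1, y) ∈ E} ∂(P.map fun ω => (ω.1.1, ω.1.2.2)) := by
  have hE' : MeasurableSet {q : ((U × S) × X) × Y | (q.1.1.1, q.2) ∈ E} :=
    hE.preimage (f := fun q : ((U × S) × X) × Y => (q.1.1.1, q.2)) (by fun_prop)
  have hh : Measurable fun q : (U × S) × X => W (q.2, q.1.2) {y | (q.1.1, y) ∈ E} :=
    Kernel.measurable_kernel_prodMk_left
      (κ := W.comap (fun q : (U × S) × X => (q.2, q.1.2)) (by fun_prop)) hE'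
  have hpre : MeasurableSet ((fun ω : (U × (X × S)) × Y => (ω.1.1, ω.2)) ⁻¹' E) :=
    hE.preimage (by fun_prop)
  have := Measure.isProbabilityMeasure_map (μ := P)
    (f := fun ω => (ω.1.1, ω.1.2.2)) (by fun_prop)
  calc P.map (fun ω => (ω.1.1, ω.2)) E
      = (P.fst.compProd (W.prodMkLeft U)) ((fun ω => (ω.1.1, ω.2)) ⁻¹' E) := by
        rw [Measure.map_apply (by fun_prop) hE, ← channel]
    _ = ∫⁻ q, W (q.2.1, q.2.2) {y | (q.1, y) ∈ E} ∂P.fst := by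
        rw [Measure.compProd_apply hpre]
        rfl
    _ = ∫⁻ ω, W (ω.1.2.1, ω.1.2.2) {y | (ω.1.1, y) ∈ E} ∂P := by
        rw [Measure.fst, lintegral_map _ measurable_fst]
        exact hh.comp (f := fun q : U × (X × S) => ((q.1, q.2.2), q.2.1)) (by fun_prop)
    _ = ∫⁻ q, W (q.2, q.1.2) {y | (q.1.1, y) ∈ E}
          ∂(P.map fun ω => ((ω.1.1, ω.1.2.2), ω.1.2.1)) := by
        rw [lintegral_map hh (by fun_prop)]
    _ = _ := by
        rw [input, Measure.lintegral_compProd hh]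
        congr 1 with p
        have hp : MeasurableSet {y | (p.1, y) ∈ E} := hE.preimage (by fun_prop)
        rw [outputKernel_apply K W p hp]

theorem exists_code_of_joint_law (P : Measure ((U × (X × S)) × Y)) [IsProbabilityMeasure P]
    (W : Kernel (X × S) Y) [IsMarkovKernel W] (K : Kernel (U × S) X) [IsMarkovKernel K]
    (channel : P = P.fst.compProd (W.prodMkLeft U))
    (input : P.map (fun ω => ((ω.1.1, ω.1.2.2), ω.1.2.1)) =
      (P.map (fun ω => (ω.1.1, ω.1.2.2))).compProd K)
    (α β : ℝ) {θ : ℝ≥0∞} (hθ : θ ≠ 0) (hθ' : θ ≠ ⊤) (t : ℝ≥0∞) {M L : ℕ} (hM : 0 < M)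
    (hL : 0 < L) :
    ∃ (enc : Fin M → Kernel S X) (dec : Y → Fin M), (∀ m, IsMarkovKernel (enc m)) ∧
      Measurable dec ∧
      (M : ℝ≥0∞)⁻¹ * ∑ m : Fin M, ∫⁻ s, ∫⁻ x, W (x, s) {y | dec y ≠ m} ∂(enc m s)
          ∂(P.map fun ω => ω.1.2.2) ≤
        P.map (fun ω => (ω.1.1, ω.1.2.2))
            {z | (α : EReal) < infoDensity (P.map fun ω => (ω.1.1, ω.1.2.2)) z} +
          P.map (fun ω => (ω.1.1, ω.2))
            {z | infoDensity (P.map fun ω => (ω.1.1, ω.2)) z ≤ (β : EReal)} / θ +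
          ENNReal.ofReal (Real.exp α) * t + (1 - t) ^ L + θ +
          M * (L * ENNReal.ofReal (Real.exp (-β))) := by
  set PUS := P.map fun ω => (ω.1.1, ω.1.2.2) with hPUS
  set PUY := P.map fun ω => (ω.1.1, ω.2) with hPUY
  have : IsProbabilityMeasure PUS := Measure.isProbabilityMeasure_map (by fun_prop)
  have : IsProbabilityMeasure PUY := Measure.isProbabilityMeasure_map (by fun_prop)
  have hfst : PUY.fst = PUS.fst := by
    rw [Measure.fst, Measure.fst, Measure.map_map (by fun_prop) (by fun_prop),
      Measure.map_map (by fun_prop) (by fun_prop)]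
    rfl
  have hsnd : (P.map fun ω => ω.1.2.2) = PUS.snd := by
    rw [Measure.snd, Measure.map_map (by fun_prop) (by fun_prop)]
    rfl
  set T₀ : Set (U × Y) := {z | (β : EReal) < infoDensity PUY z}
  have hT₀ : MeasurableSet T₀ := measurableSet_lt measurable_const (measurable_infoDensity _)
  set δ := ENNReal.ofReal (Real.exp (-β))
  -- Random coding needs the false-alarm bound at every `y`, but it holds only almost everywhere;
  -- the exceptional null set is cut out of the test.
  set N : Set Y := {y | δ < PUY.fst {u | (u, y) ∈ T₀}}
  have hN : MeasurableSet N :=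
    measurableSet_lt measurable_const (measurable_measure_prodMk_right hT₀)
  have hN0 : PUY (Prod.snd ⁻¹' N) = 0 := by
    rw [← Measure.snd_apply hN]
    have := ae_iff.1 (ae_measure_lt_infoDensity_le PUY β)
    simp only [not_le] at this
    exact this
  set T : Set (U × Y) := T₀ ∩ Prod.snd ⁻¹' Nᶜ
  have hT : MeasurableSet T := hT₀.inter (measurable_snd hN.compl)
  have hTδ : ∀ y, PUS.fst {u | (u, y) ∈ T} ≤ δ := fun y => by
    by_cases hy : y ∈ N
    · have : {u | (u, y) ∈ T} = ∅ := by ext u; simp [T, hy]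
      simp [this]
    · rw [← hfst]
      exact (measure_mono fun u hu => hu.1).trans (not_lt.1 hy)
  have hTc : PUY Tᶜ ≤ PUY {z | infoDensity PUY z ≤ (β : EReal)} := by
    have : Tᶜ ⊆ {z | infoDensity PUY z ≤ (β : EReal)} ∪ Prod.snd ⁻¹' N := by
      intro z hz
      by_cases hzN : z.2 ∈ N
      · exact Or.inr hzN
      · exact Or.inl (Set.mem_ofPred.2 (not_lt.1 fun h => hz ⟨h, hzN⟩))
    exact (measure_mono this).trans ((measure_union_le _ _).trans (by rw [hN0, add_zero]))
  set g : U × S → ℝ≥0∞ := fun p => outputKernel K W p {y | (p.1, y) ∉ T}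
  have hg : Measurable g := by
    have : MeasurableSet {q : (U × S) × Y | (q.1.1, q.2) ∈ Tᶜ} :=
      hT.compl.preimage (f := fun q : (U × S) × Y => (q.1.1, q.2)) (by fun_prop)
    exact Kernel.measurable_kernel_prodMk_left this
  have hgint : ∫⁻ p, g p ∂PUS ≤ PUY {z | infoDensity PUY z ≤ (β : EReal)} :=
    (map_output_apply channel input hT.compl).symm.le.trans hTc
  -- The second condition makes the encoder avoid pairs likely to fail the decoder's test; Markov's
  -- inequality prices it at the division by `θ`.
  set G : Set (U × S) := {p | infoDensity PUS p ≤ (α : EReal)} ∩ {p | g p ≤ θ}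
  have hG : MeasurableSet G := (measurableSet_le (measurable_infoDensity _) measurable_const).inter
    (measurableSet_le hg measurable_const)
  have hGc : PUS Gᶜ ≤ PUS {z | (α : EReal) < infoDensity PUS z} +
      PUY {z | infoDensity PUY z ≤ (β : EReal)} / θ := by
    have : Gᶜ ⊆ {z | (α : EReal) < infoDensity PUS z} ∪ {p | θ ≤ g p} := by
      intro z hz
      by_cases h : infoDensity PUS z ≤ (α : EReal)
      · exact Or.inr (Set.mem_ofPred.2 (not_le.1 fun h' => hz ⟨h, h'⟩).le)
      · exact Or.inl (not_le.1 h)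
    refine (measure_mono this).trans ((measure_union_le _ _).trans ?_)
    gcongr
    exact (meas_ge_le_lintegral_div hg.aemeasurable hθ hθ').trans (by gcongr)
  obtain ⟨enc, dec, henc, hdec, herr⟩ := exists_code_of_random_coding PUS.fst PUS.snd K W hG hT
    (fun p hp => hp.2) hTδ hM hL
  refine ⟨enc, dec, henc, hdec, ?_⟩
  rw [hsnd]
  refine herr.trans ?_
  gcongr
  refine (lintegral_pow_le_of_infoDensity_le PUS hG (fun z hz => hz.1) t L).trans ?_
  gcongr

end OneShot

/-! ### Asymptotic achievability. -/

section Achievability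

/-- With t = exp(-n(x + γ)), one has L t ≥ exp(nγ) ≥ nγ, and (1 - t)^L ≤ exp(-L t). -/
lemma one_sub_pow_le {n : ℕ} {x γ : ℝ} (hx : 0 ≤ n * (x + γ)) {L : ℕ}
    (hL : Real.exp (n * (x + 2 * γ)) ≤ L) :
    (1 - ENNReal.ofReal (Real.exp (-(n * (x + γ))))) ^ L ≤
      ENNReal.ofReal (Real.exp (-(n * γ))) := by
  set t := Real.exp (-(n * (x + γ))) with ht
  have ht1 : t ≤ 1 := Real.exp_le_one_iff.2 (by linarith)
  rw [← ENNReal.ofReal_one, ← ENNReal.ofReal_sub _ (Real.exp_pos _).le,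
    ← ENNReal.ofReal_pow (by linarith)]
  refine ENNReal.ofReal_le_ofReal ?_
  have h1 : 1 - t ≤ Real.exp (-t) := by linarith [Real.add_one_le_exp (-t)]
  have h2 : Real.exp (n * γ) ≤ L * t := by
    calc Real.exp (n * γ) = Real.exp (n * (x + 2 * γ)) * t := by
          rw [ht, ← Real.exp_add]; ring_nf
      _ ≤ L * t := by gcongr
  calc (1 - t) ^ L ≤ Real.exp (-t) ^ L := pow_le_pow_left₀ (by linarith) h1 L
    _ = Real.exp (-(L * t)) := by rw [← Real.exp_nat_mul]; ring_nf
    _ ≤ _ := Real.exp_le_exp.2 (by linarith [Real.add_one_le_exp (n * γ)])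

lemma natCeil_exp_le_two_mul {x : ℝ} (hx : 0 ≤ x) :
    (⌈Real.exp x⌉₊ : ℝ) ≤ 2 * Real.exp x := by
  have := Nat.ceil_lt_add_one (Real.exp_pos x).le
  linarith [Real.one_le_exp hx]

lemma natCeil_mul_le {n : ℕ} {R x γ : ℝ} (hR : 0 ≤ n * R) (hx : 0 ≤ n * (x + 2 * γ)) :
    (⌈Real.exp (n * R)⌉₊ : ℝ≥0∞) * (⌈Real.exp (n * (x + 2 * γ))⌉₊ *
      ENNReal.ofReal (Real.exp (-(n * (R + x + 3 * γ))))) ≤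
      4 * ENNReal.ofReal (Real.exp (-(n * γ))) := by
  have h4 : (4 : ℝ≥0∞) = ENNReal.ofReal 4 := by simp
  rw [← ENNReal.ofReal_natCast, ← ENNReal.ofReal_natCast, h4,
    ← ENNReal.ofReal_mul (by positivity), ← ENNReal.ofReal_mul (by positivity),
    ← ENNReal.ofReal_mul (by positivity)]
  refine ENNReal.ofReal_le_ofReal ?_
  calc _ ≤ (2 * Real.exp (n * R)) * ((2 * Real.exp (n * (x + 2 * γ))) *
        Real.exp (-(n * (R + x + 3 * γ)))) := by
        gcongr <;> exact natCeil_exp_le_two_mul ‹_›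
    _ = 4 * (Real.exp (n * R) * Real.exp (n * (x + 2 * γ)) *
        Real.exp (-(n * (R + x + 3 * γ)))) := by ring
    _ = _ := by
        rw [← Real.exp_add, ← Real.exp_add]
        ring_nf

variable {𝒳 : Type a} {𝒮 : Type b} {𝒴 : Type c}
  [MeasurableSpace 𝒳] [MeasurableSpace 𝒮] [MeasurableSpace 𝒴]
  {W : ∀ n : ℕ, Kernel ((Fin n → 𝒳) × (Fin n → 𝒮)) (Fin n → 𝒴)} [∀ n, IsMarkovKernel (W n)]
  {PS : ∀ n : ℕ, Measure (Fin n → 𝒮)}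

theorem isAchievableRate_of_lt {𝒰 : Type v} [MeasurableSpace 𝒰]
    {P : ∀ n : ℕ, Measure (((Fin n → 𝒰) × ((Fin n → 𝒳) × (Fin n → 𝒮))) × (Fin n → 𝒴))}
    (hP : IsGPProcess W PS P) {R : ℝ} (hR : 0 ≤ R)
    (h : (R : EReal) < spectralInfMI (fun n => (P n).map (fun ω => (ω.1.1, ω.2))) -
        spectralSupMI (fun n => (P n).map (fun ω => (ω.1.1, ω.1.2.2))))
    {θ : ℝ≥0∞} (hθ : θ ≠ 0) (hθ' : θ ≠ ⊤) :
    IsAchievableRate W PS θ R := by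
  have := hP.prob
  have hUS : ∀ n, IsProbabilityMeasure ((P n).map (fun ω => (ω.1.1, ω.1.2.2))) := fun n =>
    Measure.isProbabilityMeasure_map (by fun_prop)
  set PUS := fun n => (P n).map (fun ω => (ω.1.1, ω.1.2.2)) with hPUS
  set PUY := fun n => (P n).map (fun ω => (ω.1.1, ω.2)) with hPUY
  have hUS0 : 0 ≤ spectralSupMI PUS := spectralSupMI_nonneg
  -- The gap between R + Ī and I_ is split into steps γ: t = exp(-n(x+γ)), L ≈ exp(n(x+2γ)) and β =
  -- n(R+x+3γ) leave each exponential error term a factor exp(-nγ).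
  obtain ⟨x, γ, hx, hγ, hxs, hxi⟩ : ∃ x γ : ℝ, 0 ≤ x ∧ 0 < γ ∧ spectralSupMI PUS < (x : EReal) ∧
      ((R + x + 3 * γ : ℝ) : EReal) < spectralInfMI PUY := by
    generalize spectralSupMI PUS = I₁ at *
    generalize spectralInfMI PUY = I₂ at *
    induction I₁ using EReal.rec with
    | bot => simp at hUS0
    -- Here the convention ∞ - ∞ = -∞ is used: subtracting `⊤` always gives `⊥`, which exceeds no
    -- real rate.
    | top => simp at h
    | coe i =>
      have hi : 0 ≤ i := by exact_mod_cast hUS0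
      have h' : ((R + i : ℝ) : EReal) < I₂ := by
        rw [EReal.coe_add]
        exact (EReal.lt_sub_iff_add_lt (Or.inl (EReal.coe_ne_bot _))
          (Or.inl (EReal.coe_ne_top _))).1 h
      obtain ⟨b', hb1, hb2⟩ := EReal.lt_iff_exists_real_btwn.1 h'
      have hb1' : R + i < b' := by exact_mod_cast hb1
      refine ⟨i + (b' - R - i) / 5, (b' - R - i) / 5, by linarith, by linarith, ?_, ?_⟩
      · exact_mod_cast (by linarith : i < i + (b' - R - i) / 5)
      · refine lt_trans ?_ hb2
        exact_mod_cast (by linarith : R + (i + (b' - R - i) / 5) + 3 * ((b' - R - i) / 5) < b')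
  have hlimS := tendsto_measure_of_pLimsup_lt hxs
  have hlimY := tendsto_measure_of_lt_pLiminf hxi
  have hexp := tendsto_ofReal_exp_neg_mul hγ
  set E₁ : ℕ → ℝ≥0∞ := fun n =>
    PUS n {z | ((n * x : ℝ) : EReal) < infoDensity (PUS n) z}
  set E₂ : ℕ → ℝ≥0∞ := fun n =>
    PUY n {z | infoDensity (PUY n) z ≤ ((n * (R + x + 3 * γ) : ℝ) : EReal)}
  have hE₁ : Tendsto E₁ atTop (𝓝 0) := by
    refine tendsto_of_tendsto_of_tendsto_of_le_of_le' tendsto_const_nhds hlimS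
      (Eventually.of_forall fun _ => zero_le) ?_
    filter_upwards [eventually_gt_atTop 0] with n hn
    refine measure_mono fun z hz => ?_
    exact (not_le.1 fun hle => (not_le.2 hz) ((EReal.div_natCast_le_coe_iff hn).1 hle)).le
  have hE₂ : Tendsto E₂ atTop (𝓝 0) := by
    refine tendsto_of_tendsto_of_tendsto_of_le_of_le' tendsto_const_nhds hlimY
      (Eventually.of_forall fun _ => zero_le) ?_
    filter_upwards [eventually_gt_atTop 0] with n hn
    exact measure_mono fun z hz => (EReal.div_natCast_le_coe_iff hn).2 hz
  set ex : ℕ → ℝ≥0∞ := fun n => ENNReal.ofReal (Real.exp (-(n * γ)))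
  refine ⟨hR, fun n => ⌈Real.exp (n * R)⌉₊,
    fun n => E₁ n + E₂ n / θ + ex n + ex n + θ + 4 * ex n, fun n => ?_, ?_, ?_⟩
  · have hM : 0 < ⌈Real.exp (n * R)⌉₊ := Nat.ceil_pos.2 (Real.exp_pos _)
    have hL : 0 < ⌈Real.exp (n * (x + 2 * γ))⌉₊ := Nat.ceil_pos.2 (Real.exp_pos _)
    obtain ⟨K, hK, hin⟩ := hP.input n
    obtain ⟨enc, dec, henc, hdec, herr⟩ := exists_code_of_joint_law (P n) (W n) K (hP.channel n)
      hin (n * x) (n * (R + x + 3 * γ)) hθ hθ' (ENNReal.ofReal (Real.exp (-(n * (x + γ))))) hM hL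
    refine ⟨hM, ⟨enc, henc, dec, hdec⟩, ?_⟩
    rw [hP.state n] at herr
    refine herr.trans ?_
    change _ ≤ E₁ n + E₂ n / θ + ex n + ex n + θ + 4 * ex n
    gcongr ?_ + ?_ + ?_ + ?_ + _ + ?_
    · exact le_rfl
    · exact le_rfl
    · rw [← ENNReal.ofReal_mul (Real.exp_pos _).le, ← Real.exp_add]
      exact ENNReal.ofReal_le_ofReal (Real.exp_le_exp.2 (by linarith))
    · exact one_sub_pow_le (by positivity) (Nat.le_ceil _)
    · exact natCeil_mul_le (by positivity) (by positivity)
  · refine le_liminf_of_le (by isBoundedDefault) ?_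
    filter_upwards [eventually_gt_atTop 0] with n hn
    have hn' : (0 : ℝ) < n := by exact_mod_cast hn
    rw [EReal.coe_le_coe_iff, le_div_iff₀ hn', mul_comm]
    exact (Real.le_log_iff_exp_le (by exact_mod_cast Nat.ceil_pos.2 (Real.exp_pos _))).2
      (Nat.le_ceil _)
  · refine le_of_eq (Tendsto.limsup_eq ?_)
    have h2 : Tendsto (fun n => E₂ n / θ) atTop (𝓝 0) := by
      simpa using ENNReal.Tendsto.div_const hE₂ (Or.inr hθ)
    have h3 : Tendsto (fun n => 4 * ex n) atTop (𝓝 0) := by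
      simpa using ENNReal.Tendsto.const_mul hexp (Or.inr (by simp : (4 : ℝ≥0∞) ≠ ⊤))
    simpa using ((((hE₁.add h2).add hexp).add hexp).add tendsto_const_nhds).add h3

end Achievability

/-! ### Converse: a code as an admissible process. -/

section Converse

section JointLaw

variable {U S X Y : Type*} [MeasurableSpace U] [MeasurableSpace S] [MeasurableSpace X]
  [MeasurableSpace Y]

/-- Verdú–Han: under the product law the decoder guesses the message with probability at most 1/M,
and change of measure carries this to the correctly decoded pairs of low density. -/
lemma measure_infoDensity_le_le (Q : Measure (U × Y)) [IsProbabilityMeasure Q] {M : ℕ}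
    {ψ : U → Fin M} (hψ : Measurable ψ) {dec : Y → Fin M} (hdec : Measurable dec)
    (hunif : ∀ m, Q.fst (ψ ⁻¹' {m}) ≤ (M : ℝ≥0∞)⁻¹) (r : ℝ) :
    Q {z | infoDensity Q z ≤ (r : EReal)} ≤
      Q {z | dec z.2 ≠ ψ z.1} + ENNReal.ofReal (Real.exp r) * (M : ℝ≥0∞)⁻¹ := by
  have hD : MeasurableSet {z : U × Y | dec z.2 = ψ z.1} :=
    measurableSet_eq_fun (hdec.comp measurable_snd) (hψ.comp measurable_fst)
  have hE : MeasurableSet {z | infoDensity Q z ≤ (r : EReal)} :=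
    measurableSet_le (measurable_infoDensity Q) measurable_const
  have hprod : (Q.fst.prod Q.snd) {z | dec z.2 = ψ z.1} ≤ (M : ℝ≥0∞)⁻¹ := by
    rw [Measure.prod_apply_symm hD]
    refine (lintegral_mono (g := fun _ => (M : ℝ≥0∞)⁻¹) fun y => ?_).trans (by simp)
    refine (measure_mono fun u hu => ?_).trans (hunif (dec y))
    exact Eq.symm hu
  calc Q {z | infoDensity Q z ≤ (r : EReal)}
      ≤ Q ({z | dec z.2 ≠ ψ z.1} ∪
          {z | infoDensity Q z ≤ (r : EReal)} ∩ {z | dec z.2 = ψ z.1}) := by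
        refine measure_mono fun z hz => ?_
        by_cases h : dec z.2 = ψ z.1
        · exact Or.inr ⟨hz, h⟩
        · exact Or.inl h
    _ ≤ Q {z | dec z.2 ≠ ψ z.1} +
          Q ({z | infoDensity Q z ≤ (r : EReal)} ∩ {z | dec z.2 = ψ z.1}) := measure_union_le _ _
    _ ≤ _ := by
        gcongr
        refine (measure_le_of_infoDensity_le Q (hE.inter hD) fun z hz => hz.1).trans ?_
        gcongr
        exact (measure_mono Set.inter_subset_right).trans hprod

/-- The joint law of `((u, (x, s)), y)` for independent `u` and `s`, with `x` drawn from `K (u, s)`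
and `y` from `W (x, s)`. -/
noncomputable def independentStateLaw (PU : Measure U) (PS : Measure S) (K : Kernel (U × S) X)
    (W : Kernel (X × S) Y) : Measure ((U × (X × S)) × Y) :=
  (((PU.prod PS).compProd K).map fun q => (q.1.1, (q.2, q.1.2))).compProd (W.prodMkLeft U)

variable (PU : Measure U) [IsProbabilityMeasure PU] (PS : Measure S) [IsProbabilityMeasure PS]
  (K : Kernel (U × S) X) [IsMarkovKernel K] (W : Kernel (X × S) Y) [IsMarkovKernel W]

lemma fst_independentStateLaw : (independentStateLaw PU PS K W).fst =
    ((PU.prod PS).compProd K).map fun q => (q.1.1, (q.2, q.1.2)) := by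
  have := Measure.isProbabilityMeasure_map (μ := (PU.prod PS).compProd K)
    (f := fun q => (q.1.1, (q.2, q.1.2))) (by fun_prop)
  exact Measure.fst_compProd _ _

instance : IsProbabilityMeasure (independentStateLaw PU PS K W) := by
  have := Measure.isProbabilityMeasure_map (μ := (PU.prod PS).compProd K)
    (f := fun q => (q.1.1, (q.2, q.1.2))) (by fun_prop)
  unfold independentStateLaw
  infer_instance

lemma independentStateLaw_channel : independentStateLaw PU PS K W =
    (independentStateLaw PU PS K W).fst.compProd (W.prodMkLeft U) := by
  rw [fst_independentStateLaw]
  rfl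

lemma map_independentStateLaw {Z : Type*} [MeasurableSpace Z] {f : U × (X × S) → Z}
    (hf : Measurable f) : (independentStateLaw PU PS K W).map (fun ω => f ω.1) =
      ((PU.prod PS).compProd K).map fun q => f (q.1.1, (q.2, q.1.2)) := by
  have h : (independentStateLaw PU PS K W).map (fun ω => f ω.1) =
      (independentStateLaw PU PS K W).fst.map f := by
    rw [Measure.fst, Measure.map_map hf measurable_fst]
    rfl
  rw [h, fst_independentStateLaw, Measure.map_map hf (by fun_prop)]
  rfl

lemma map_state_independentStateLaw :
    (independentStateLaw PU PS K W).map (fun ω => (ω.1.1, ω.1.2.2)) = PU.prod PS := by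
  rw [map_independentStateLaw PU PS K W (f := fun q => (q.1, q.2.2)) (by fun_prop)]
  exact Measure.fst_compProd _ _

lemma independentStateLaw_input :
    (independentStateLaw PU PS K W).map (fun ω => ((ω.1.1, ω.1.2.2), ω.1.2.1)) =
      ((independentStateLaw PU PS K W).map (fun ω => (ω.1.1, ω.1.2.2))).compProd K := by
  rw [map_state_independentStateLaw,
    map_independentStateLaw PU PS K W (f := fun q => ((q.1, q.2.2), q.2.1)) (by fun_prop)]
  exact Measure.map_id

lemma independentStateLaw_state :
    (independentStateLaw PU PS K W).map (fun ω => ω.1.2.2) = PS := by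
  have h : (independentStateLaw PU PS K W).map (fun ω => ω.1.2.2) =
      ((independentStateLaw PU PS K W).map (fun ω => (ω.1.1, ω.1.2.2))).snd := by
    rw [Measure.snd, Measure.map_map measurable_snd (by fun_prop)]
    rfl
  rw [h, map_state_independentStateLaw, Measure.snd_prod]

end JointLaw

/-- The uniform law on the messages. -/
noncomputable def uniformMessage (M : ℕ) : Measure (Fin M) := (M : ℝ≥0∞)⁻¹ • Measure.count

instance (M : ℕ) [NeZero M] : IsProbabilityMeasure (uniformMessage M) := by
  constructor
  simp [uniformMessage, Measure.count_apply_finite,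
    ENNReal.inv_mul_cancel (by simpa using NeZero.ne M) (ENNReal.natCast_ne_top M)]

lemma lintegral_uniformMessage (M : ℕ) (f : Fin M → ℝ≥0∞) :
    ∫⁻ m, f m ∂(uniformMessage M) = (M : ℝ≥0∞)⁻¹ * ∑ m, f m := by
  rw [uniformMessage, lintegral_smul_measure, lintegral_count, tsum_fintype, smul_eq_mul]

lemma uniformMessage_singleton (M : ℕ) (m : Fin M) :
    uniformMessage M {m} = (M : ℝ≥0∞)⁻¹ := by
  simp [uniformMessage]

/-- Injectivity of `φ` is assumed only inside the bound, because sequences of length 0 cannot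
distinguish messages; the laws must exist for every blocklength. -/
lemma exists_joint_law_of_code {U S X Y : Type*} [Countable U] [MeasurableSpace U]
    [DiscreteMeasurableSpace U] [MeasurableSpace S] [MeasurableSpace X] [MeasurableSpace Y]
    {M : ℕ} (hM : 0 < M) (φ : Fin M → U) (PS : Measure S) [IsProbabilityMeasure PS]
    (W : Kernel (X × S) Y) [IsMarkovKernel W] (enc : Fin M → Kernel S X)
    [∀ m, IsMarkovKernel (enc m)] {dec : Y → Fin M} (hdec : Measurable dec) :
    ∃ (PU : Measure U) (K : Kernel (U × S) X), IsProbabilityMeasure PU ∧ IsMarkovKernel K ∧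
      (Function.Injective φ → ∀ r : ℝ,
        (independentStateLaw PU PS K W).map (fun ω => (ω.1.1, ω.2))
          {z | infoDensity ((independentStateLaw PU PS K W).map (fun ω => (ω.1.1, ω.2))) z ≤
            (r : EReal)} ≤
        (M : ℝ≥0∞)⁻¹ * ∑ m : Fin M, ∫⁻ s, ∫⁻ x, W (x, s) {y | dec y ≠ m} ∂(enc m s) ∂PS +
          ENNReal.ofReal (Real.exp r) * (M : ℝ≥0∞)⁻¹) := by
  have : NeZero M := ⟨hM.ne'⟩
  set ψ : U → Fin M := Function.invFun φ
  have hψ : Measurable ψ := measurable_of_countable ψ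
  have hφ : Measurable φ := measurable_of_countable φ
  set PU := (uniformMessage M).map φ with hPU
  have hPU' : IsProbabilityMeasure PU := Measure.isProbabilityMeasure_map hφ.aemeasurable
  set K : Kernel (U × S) X := ⟨fun p => enc (ψ p.1) p.2,
    measurable_from_prod_countable_right fun u => (enc (ψ u)).measurable⟩ with hK
  have hK' : IsMarkovKernel K := ⟨fun p => inferInstanceAs (IsProbabilityMeasure (enc (ψ p.1) p.2))⟩
  refine ⟨PU, K, hPU', hK', fun hinj r => ?_⟩
  have hψφ : ∀ m, ψ (φ m) = m := Function.leftInverse_invFun hinj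
  set Q := (independentStateLaw PU PS K W).map (fun ω => (ω.1.1, ω.2)) with hQ
  have hQ' : IsProbabilityMeasure Q := Measure.isProbabilityMeasure_map (by fun_prop)
  have hQfst : Q.fst = PU := by
    have h : Q.fst = ((independentStateLaw PU PS K W).map (fun ω => (ω.1.1, ω.1.2.2))).fst := by
      rw [Measure.fst, Measure.fst, Measure.map_map measurable_fst (by fun_prop),
        Measure.map_map measurable_fst (by fun_prop)]
      rfl
    rw [h, map_state_independentStateLaw, Measure.fst_prod]
  have hunif : ∀ m, Q.fst (ψ ⁻¹' {m}) ≤ (M : ℝ≥0∞)⁻¹ := fun m => by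
    rw [hQfst, Measure.map_apply hφ (hψ (measurableSet_singleton m)),
      ← uniformMessage_singleton M m]
    refine measure_mono fun m' hm' => ?_
    simpa [hψφ] using hm'
  refine (measure_infoDensity_le_le Q hψ hdec hunif r).trans ?_
  gcongr
  have hE : MeasurableSet {z : U × Y | dec z.2 ≠ ψ z.1} :=
    (measurableSet_eq_fun (hdec.comp measurable_snd) (hψ.comp measurable_fst)).compl
  set h : Fin M → ℝ≥0∞ := fun m => ∫⁻ s, ∫⁻ x, W (x, s) {y | dec y ≠ m} ∂(enc m s) ∂PS
  have hm : Measurable fun p : U × S => outputKernel K W p {y | dec y ≠ ψ p.1} := by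
    have : MeasurableSet {q : (U × S) × Y | dec q.2 ≠ ψ q.1.1} :=
      (measurableSet_eq_fun (hdec.comp measurable_snd)
        (hψ.comp (measurable_fst.comp measurable_fst))).compl
    exact Kernel.measurable_kernel_prodMk_left this
  refine le_of_eq ?_
  calc Q {z | dec z.2 ≠ ψ z.1}
      = ∫⁻ p, outputKernel K W p {y | dec y ≠ ψ p.1} ∂(PU.prod PS) := by
        rw [hQ, map_output_apply (independentStateLaw_channel PU PS K W)
          (independentStateLaw_input PU PS K W) hE, map_state_independentStateLaw]
        rfl
    _ = ∫⁻ u, ∫⁻ s, outputKernel K W (u, s) {y | dec y ≠ ψ u} ∂PS ∂PU :=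
        lintegral_prod _ hm.aemeasurable
    _ = ∫⁻ u, h (ψ u) ∂PU := by
        congr 1 with u
        have hD : MeasurableSet {y | dec y ≠ ψ u} := (hdec (measurableSet_singleton (ψ u))).compl
        simp_rw [outputKernel_apply K W _ hD]
        rfl
    _ = (M : ℝ≥0∞)⁻¹ * ∑ m, h m := by
        rw [hPU, lintegral_map (measurable_of_countable fun u => h (ψ u)) hφ]
        simp_rw [hψφ]
        exact lintegral_uniformMessage M h

variable {𝒳 : Type a} {𝒮 : Type b} {𝒴 : Type c}
  [MeasurableSpace 𝒳] [MeasurableSpace 𝒮] [MeasurableSpace 𝒴]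
  {W : ∀ n : ℕ, Kernel ((Fin n → 𝒳) × (Fin n → 𝒮)) (Fin n → 𝒴)}
  {PS : ∀ n : ℕ, Measure (Fin n → 𝒮)}

lemma hasGPCode_one [Nonempty 𝒳] (n : ℕ) : HasGPCode (W n) (PS n) 1 0 := by
  let x₀ : Fin n → 𝒳 := fun _ => Classical.arbitrary 𝒳
  refine ⟨one_pos, ⟨fun _ => Kernel.const _ (Measure.dirac x₀), fun _ => inferInstance, fun _ => 0,
    measurable_const⟩, ?_⟩
  simp [GPCode.error]

/-- The smallest error probability of a code with at least `exp (n * R)` messages. -/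
noncomputable def optimalError (W : ∀ n : ℕ, Kernel ((Fin n → 𝒳) × (Fin n → 𝒮)) (Fin n → 𝒴))
    (PS : ∀ n : ℕ, Measure (Fin n → 𝒮)) (R : ℝ) (n : ℕ) : ℝ≥0∞ :=
  sInf {ε | ∃ M : ℕ, Real.exp (n * R) ≤ M ∧ HasGPCode (W n) (PS n) M ε}

/-- The strict gap R < R' turns the liminf condition on log M / n into M ≥ exp(nR) for all large
`n`. -/
lemma limsup_optimalError_le {R R' : ℝ} (hR : R < R') {ε : ℝ≥0∞}
    (h : IsAchievableRate W PS ε R') : limsup (optimalError W PS R) atTop ≤ ε := by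
  obtain ⟨-, M, e, hcode, hM, he⟩ := h
  refine (limsup_le_limsup ?_).trans he
  have h1 := eventually_lt_of_lt_liminf (lt_of_lt_of_le (EReal.coe_lt_coe_iff.2 hR) hM)
  filter_upwards [h1, eventually_gt_atTop 0] with n hn hn0
  refine sInf_le ⟨M n, ?_, hcode n⟩
  have hn' : (0 : ℝ) < n := by exact_mod_cast hn0
  rw [EReal.coe_lt_coe_iff, lt_div_iff₀ hn', mul_comm] at hn
  exact (Real.le_log_iff_exp_le (by exact_mod_cast (hcode n).1)).1 hn.le

variable [∀ n, IsMarkovKernel (W n)] [∀ n, IsProbabilityMeasure (PS n)]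

theorem le_gpFormula_of_codes {R : ℝ} {M : ℕ → ℕ} {e : ℕ → ℝ≥0∞}
    (hcode : ∀ n, HasGPCode (W n) (PS n) (M n) (e n))
    (hM : ∀ᶠ n : ℕ in atTop, Real.exp (n * R) ≤ M n) (he : Tendsto e atTop (𝓝 0)) :
    (R : EReal) ≤ gpFormula.{v} W PS := by
  let mU : MeasurableSpace (ULift.{v} ℕ) := ⊤
  have hdU : DiscreteMeasurableSpace (ULift.{v} ℕ) := ⟨fun _ => trivial⟩
  choose hpos code herr using hcode
  have := fun n => (code n).enc_markov
  -- A message becomes a constant sequence. One alphabet must serve all blocklengths while `M n` may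
  -- be unbounded, hence ℕ, lifted to the required universe.
  let φ : ∀ n, Fin (M n) → Fin n → ULift.{v} ℕ := fun n m _ => ⟨m⟩
  have hφ : ∀ n, 0 < n → Function.Injective (φ n) := fun n hn m m' h => by
    simpa [φ, Fin.ext_iff] using congrFun h ⟨0, hn⟩
  choose PU K hPU hK hbound using fun n => exists_joint_law_of_code (hpos n) (φ n) (PS n) (W n)
    (code n).enc (code n).dec_measurable
  set P := fun n => independentStateLaw (PU n) (PS n) (K n) (W n) with hP
  have hproc : IsGPProcess W PS P :=
    { prob := fun n => inferInstance
      state := fun n => independentStateLaw_state _ _ _ _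
      channel := fun n => independentStateLaw_channel _ _ _ _
      input := fun n => ⟨K n, hK n, independentStateLaw_input _ _ _ _⟩ }
  have hsup : spectralSupMI (fun n => (P n).map (fun ω => (ω.1.1, ω.1.2.2))) ≤ 0 := by
    refine pLimsup_le ?_
    refine tendsto_const_nhds.congr fun n => Eq.symm ?_
    simp only [hP, map_state_independentStateLaw]
    have h0 := infoDensity_ae_eq_zero_of_eq_prod ((PU n).prod (PS n))
      (by rw [Measure.fst_prod, Measure.snd_prod])
    have h1 : ∀ᵐ z ∂(PU n).prod (PS n),
        ¬ 0 < infoDensity ((PU n).prod (PS n)) z / (n : EReal) := by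
      filter_upwards [h0] with z hz
      simp [hz]
    simpa [ae_iff] using h1
  have hinf : (R : EReal) ≤ spectralInfMI (fun n => (P n).map (fun ω => (ω.1.1, ω.2))) := by
    refine EReal.ge_of_forall_gt_iff_ge.1 fun r hr => ?_
    have hr' : 0 < R - r := sub_pos.2 (by exact_mod_cast hr)
    refine le_pLiminf ?_
    have hlim := he.add (tendsto_ofReal_exp_neg_mul hr')
    rw [add_zero] at hlim
    refine tendsto_of_tendsto_of_tendsto_of_le_of_le' tendsto_const_nhds hlim
      (Eventually.of_forall fun _ => zero_le) ?_
    filter_upwards [eventually_gt_atTop 0, hM] with n hn hMn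
    refine (measure_mono fun z hz => ?_).trans ((hbound n (hφ n hn) (n * r)).trans ?_)
    · exact (EReal.div_natCast_le_coe_iff hn).1 (le_of_lt hz)
    · gcongr
      · exact herr n
      · rw [← ENNReal.ofReal_natCast,
          ← ENNReal.ofReal_inv_of_pos ((Real.exp_pos _).trans_le hMn),
          ← ENNReal.ofReal_mul (Real.exp_pos _).le]
        refine ENNReal.ofReal_le_ofReal ?_
        rw [← div_eq_mul_inv, div_le_iff₀ ((Real.exp_pos _).trans_le hMn)]
        calc Real.exp (n * r) = Real.exp (-(n * (R - r))) * Real.exp (n * R) := by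
              rw [← Real.exp_add]; ring_nf
          _ ≤ _ := by gcongr
  refine le_trans ?_ (le_sSup ⟨ULift.{v} ℕ, mU, P, hproc, rfl⟩)
  calc (R : EReal) = R - 0 := by simp
    _ ≤ _ := EReal.sub_le_sub hinf hsup

theorem sInf_epsCapacity_le_gpFormula [Nonempty 𝒳] :
    sInf ((fun ε => epsCapacity W PS ε) '' Set.Ioi 0) ≤ gpFormula.{v} W PS := by
  refine EReal.ge_of_forall_gt_iff_ge.1 fun R hR => ?_
  have hopt : Tendsto (optimalError W PS R) atTop (𝓝 0) := by
    refine tendsto_of_le_liminf_of_limsup_le zero_le (le_of_forall_gt fun ε hε => ?_)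
    obtain ⟨ε', hε'0, hε'⟩ := exists_between hε
    obtain ⟨_, ⟨R', hR', rfl⟩, hlt⟩ := lt_sSup_iff.1 (hR.trans_le (sInf_le ⟨ε', hε'0, rfl⟩))
    exact (limsup_optimalError_le (by exact_mod_cast hlt) hR').trans_lt hε'
  -- The infimum need not be attained, hence the slack 1/n. Where no code is large enough, which
  -- happens for finitely many `n` only, the one-message code fills in.
  have hex : ∀ n : ℕ, ∃ (M : ℕ) (e : ℝ≥0∞), HasGPCode (W n) (PS n) M e ∧
      (optimalError W PS R n < ⊤ →
        Real.exp (n * R) ≤ M ∧ e ≤ optimalError W PS R n + (n : ℝ≥0∞)⁻¹) := fun n => by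
    by_cases h : optimalError W PS R n < ⊤
    · have hlt : optimalError W PS R n < optimalError W PS R n + (n : ℝ≥0∞)⁻¹ :=
        ENNReal.lt_add_right h.ne (by simp)
      obtain ⟨e, ⟨M, hM, hcode⟩, he⟩ := sInf_lt_iff.1 hlt
      exact ⟨M, e, hcode, fun _ => ⟨hM, he.le⟩⟩
    · exact ⟨1, 0, hasGPCode_one n, fun h' => absurd h' h⟩
  choose M e hcode hMe using hex
  have hfin : ∀ᶠ n in atTop, optimalError W PS R n < ⊤ := hopt.eventually_lt_const (by simp)
  refine le_gpFormula_of_codes hcode (hfin.mono fun n hn => (hMe n hn).1) ?_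
  have hlim := hopt.add ENNReal.tendsto_inv_nat_nhds_zero
  rw [add_zero] at hlim
  exact tendsto_of_tendsto_of_tendsto_of_le_of_le' tendsto_const_nhds hlim
    (Eventually.of_forall fun _ => zero_le) (hfin.mono fun n hn => (hMe n hn).2)

end Converse

/-! ### The limit of the ε-capacities. -/

section Capacity

variable {𝒳 : Type a} {𝒮 : Type b} {𝒴 : Type c}
  [MeasurableSpace 𝒳] [MeasurableSpace 𝒮] [MeasurableSpace 𝒴]
  (W : ∀ n : ℕ, Kernel ((Fin n → 𝒳) × (Fin n → 𝒮)) (Fin n → 𝒴))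
  (PS : ∀ n : ℕ, Measure (Fin n → 𝒮))

lemma monotone_epsCapacity : Monotone fun ε => epsCapacity W PS ε := by
  intro ε ε' h
  refine sSup_le_sSup ?_
  rintro _ ⟨R, ⟨hR, M, e, hcode, hM, he⟩, rfl⟩
  exact ⟨R, ⟨hR, M, e, hcode, hM, he.trans h⟩, rfl⟩

lemma epsCapacity_nonneg [Nonempty 𝒳] (ε : ℝ≥0∞) : 0 ≤ epsCapacity W PS ε := by
  refine le_sSup ⟨0, ⟨le_rfl, fun _ => 1, fun _ => 0, fun n => hasGPCode_one n, ?_, ?_⟩, by simp⟩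
  · simp
  · simp

theorem gpFormula_le_epsCapacity [Nonempty 𝒳] [∀ n, IsMarkovKernel (W n)] {ε : ℝ≥0∞}
    (hε : 0 < ε) : gpFormula.{v} W PS ≤ epsCapacity W PS ε := by
  -- Passing to a smaller θ ensures finiteness, as ε may be `⊤`.
  obtain ⟨θ, hθ, hθε⟩ := exists_between hε
  refine le_trans (sSup_le ?_) (monotone_epsCapacity W PS hθε.le)
  rintro _ ⟨𝒰, _, P, hP, rfl⟩
  refine EReal.ge_of_forall_gt_iff_ge.1 fun R hR => ?_
  rcases le_total 0 R with h0 | h0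
  · exact le_sSup ⟨R, isAchievableRate_of_lt hP h0 hR hθ.ne' (hθε.trans_le le_top).ne, rfl⟩
  · exact le_trans (by exact_mod_cast h0) (epsCapacity_nonneg W PS θ)

end Capacity

/-- The capacity `lim_{ε → 0} C_ε` of the general Gel'fand-Pinsker channel. -/
theorem theorem1 {𝒳 : Type a} {𝒮 : Type b} {𝒴 : Type c} [Nonempty 𝒳]
    [MeasurableSpace 𝒳] [MeasurableSpace 𝒮] [MeasurableSpace 𝒴]
    (W : ∀ n : ℕ, Kernel ((Fin n → 𝒳) × (Fin n → 𝒮)) (Fin n → 𝒴))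
    [∀ n, IsMarkovKernel (W n)]
    (PS : ∀ n : ℕ, Measure (Fin n → 𝒮)) [∀ n, IsProbabilityMeasure (PS n)] :
    Tendsto (fun ε : ℝ≥0∞ => epsCapacity W PS ε) (𝓝[>] 0) (𝓝 (gpFormula.{v} W PS)) := by
  have h := (monotone_epsCapacity W PS).tendsto_nhdsGT 0
  have heq : sInf ((fun ε => epsCapacity W PS ε) '' Set.Ioi 0) = gpFormula.{v} W PS := by
    refine le_antisymm sInf_epsCapacity_le_gpFormula (le_sInf ?_)
    rintro _ ⟨ε, hε, rfl⟩
    exact gpFormula_le_epsCapacity W PS hε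
  rwa [heq] at h
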